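/- Let $N\ge 1$ and $[N]=\{1,\dots,N\}$. Ordered Search on $N$ elements is the partial function that is defined on those $x:[N]\to\{0,1\}$ for which there is $i\in[N]$ with $x(j)=1$ for all $j\ge i$ and $x(j)=0$ for all $j<i$; its value at such an $x$ is this (unique) index $i$. A nonadaptive quantum algorithm that makes $T$ queries is given by two unitary operators $U,V$ on the space with orthonormal basis $|i_1,\dots,i_T\rangle|\varphi_1,\dots,\varphi_T\rangle|\psi\rangle$, where $i_k\in[N]$, $\varphi_k\in\{0,1\}$ and $\psi$ ranges over the bit strings of some finite length. On input $x$ it computes the state $V\,O_x^T\,U|0\rangle$, where $|0\rangle$ is a fixed basis state and $$O_x^T|i_1,\dots,i_T\rangle|\varphi_1,\dots,\varphi_T\rangle|\psi\rangle=|i_1,\dots,i_T\rangle|\varphi_1\oplus x(i_1),\dots,\varphi_T\oplus x(i_T)\rangle|\psi\rangle,$$ measures it in this basis, and outputs a fixed function of the outcome, with values in $[N]$. For $\varepsilon\ge 0$, let $Q^{na}_{2,\varepsilon}(\text{Ordered Search})$ be the smallest $T$ for which some nonadaptive quantum algorithm that makes $T$ queries outputs the value of Ordered Search with probability at least $1-\varepsilon$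 on every $x$ in its domain (such a $T$ exists). Then for every $\varepsilon\in[0,\tfrac12)$, $$Q^{na}_{2,\varepsilon}(\text{Ordered Search})\ \ge\ C_\varepsilon\,(N-1),\qquad\text{where } C_\varepsilon=\frac{1-2\sqrt{\varepsilon(1-\varepsilon)}}{2}.$$ -/

import Mathlib

/-- Labels of the computational basis of the state space of a nonadaptive algorithm with `T`
queries and `m` work qubits: `|i_1,…,i_T⟩ |φ_1,…,φ_T⟩ |ψ⟩`. -/
abbrev BasisLabel (Γ : Type*) (T m : ℕ) : Type _ :=
  (Fin T → Γ) × (Fin T → Bool) × (Fin m → Bool)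

/-- The action of the `T` simultaneous oracle calls on basis labels:
`(i, φ, ψ) ↦ (i, (φ_k ⊕ x(i_k))_k, ψ)`. -/
def queryLabel {Γ : Type*} {T m : ℕ} (x : Γ → Bool) (b : BasisLabel Γ T m) :
    BasisLabel Γ T m :=
  (b.1, fun k => xor (b.2.1 k) (x (b.1 k)), b.2.2)

/-- The matrix of the oracle operator `O_x^T` in the computational basis: it sends the basis
vector `|b⟩` to `|queryLabel x b⟩`. -/
def oracleMatrix {Γ : Type*} [DecidableEq Γ] {T m : ℕ} (x : Γ → Bool) :
    Matrix (BasisLabel Γ T m) (BasisLabel Γ T m) ℂ :=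
  Matrix.of fun c b => if c = queryLabel x b then 1 else 0

/-- A nonadaptive black-box quantum algorithm making `T` queries to a black box
`x : Γ → {0,1}`, with outputs in `S'`. It is given by its number of work qubits, two unitary
operators `U` and `V`, the basis state written `|0⟩` in which it is started (as `U` is an
arbitrary unitary, it does not matter which one it is), and the output that is associated with
the outcome of a measurement in the computational basis. An output that depends only on some of
the qubits corresponds to measuring only these. -/
structure NonadaptiveAlgorithm (Γ S' : Type*) [Fintype Γ] [DecidableEq Γ] (T : ℕ) where
  workQubits : ℕ
  U : Matrix.unitaryGroup (BasisLabel Γ T workQubits) ℂ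
  V : Matrix.unitaryGroup (BasisLabel Γ T workQubits) ℂ
  start : BasisLabel Γ T workQubits
  output : BasisLabel Γ T workQubits → S'

namespace NonadaptiveAlgorithm

variable {Γ S' : Type*} [Fintype Γ] [DecidableEq Γ] {T : ℕ}

/-- The final state `V O_x^T U |0⟩`. -/
noncomputable def finalState (A : NonadaptiveAlgorithm Γ S' T) (x : Γ → Bool) :
    BasisLabel Γ T A.workQubits → ℂ :=
  A.V.1.mulVec ((oracleMatrix x).mulVec (A.U.1.mulVec (Pi.single A.start 1)))

/-- The probability that the algorithm outputs `s` on the black box `x`. -/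
noncomputable def outputProb [DecidableEq S'] (A : NonadaptiveAlgorithm Γ S' T)
    (x : Γ → Bool) (s : S') : ℝ :=
  ∑ b : BasisLabel Γ T A.workQubits with A.output b = s, ‖A.finalState x b‖ ^ 2

/-- The algorithm computes the partial function `F` with probability of error at most `ε`. -/
def Computes [DecidableEq S'] (A : NonadaptiveAlgorithm Γ S' T) (F : (Γ → Bool) →. S')
    (ε : ℝ) : Prop :=
  ∀ x : Γ → Bool, ∀ s ∈ F x, 1 - ε ≤ A.outputProb x s

end NonadaptiveAlgorithm

/-- The numbers of queries `T` for which some nonadaptive quantum algorithm with `T` queries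
computes `F` with probability of error at most `ε`. -/
def nonadaptiveQueryCounts {Γ S' : Type*} [Fintype Γ] [DecidableEq Γ] [DecidableEq S']
    (ε : ℝ) (F : (Γ → Bool) →. S') : Set ℕ :=
  {T | ∃ A : NonadaptiveAlgorithm Γ S' T, A.Computes F ε}

/-- The nonadaptive quantum query complexity of `F`. -/
noncomputable def nonadaptiveQueryComplexity {Γ S' : Type*} [Fintype Γ] [DecidableEq Γ]
    [DecidableEq S'] (ε : ℝ) (F : (Γ → Bool) →. S') : ℕ :=
  sInf (nonadaptiveQueryCounts ε F)

/-- Ordered Search on `N` elements: the black box `x` is promised to be of the form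
`x(j) = 1` for `j ≥ i` and `x(j) = 0` for `j < i`, and the value of the partial function at such
an `x` is the index `i`. -/
noncomputable def orderedSearch (N : ℕ) : (Fin N → Bool) →. Fin N := fun x =>
  ⟨∃ i : Fin N, (∀ j, i ≤ j → x j = true) ∧ (∀ j, j < i → x j = false),
    fun h => Classical.choose h⟩

/-- The index promised in Ordered Search is unique, so the choice above is immaterial. -/
theorem mem_orderedSearch_iff {N : ℕ} (x : Fin N → Bool) (i : Fin N) :
    i ∈ orderedSearch N x ↔ (∀ j, i ≤ j → x j = true) ∧ (∀ j, j < i → x j = false) := by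
  constructor
  · rintro ⟨h, rfl⟩
    exact Classical.choose_spec h
  · intro hi
    refine ⟨⟨i, hi⟩, ?_⟩
    have h : ∃ i : Fin N, (∀ j, i ≤ j → x j = true) ∧ (∀ j, j < i → x j = false) := ⟨i, hi⟩
    have hc := Classical.choose_spec h
    change Classical.choose h = i
    rcases lt_trichotomy (Classical.choose h) i with hlt | heq | hgt
    · have h1 := hc.1 _ le_rfl
      rw [hi.2 _ hlt] at h1
      cases h1
    · exact heq
    · have h1 := hi.1 _ le_rfl
      rw [hc.2 _ hgt] at h1
      cases h1

/-- The constant `C_ε`. -/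
noncomputable def adversaryConstant (ε : ℝ) : ℝ := (1 - 2 * √(ε * (1 - ε))) / 2

open Matrix Finset

/-! The queries are fixed in advance, so the state before the oracle call does not depend on the
input. In it, each index has a weight, the probability of being among those queried, and these
weights sum to at most `T`. Inputs with neighbouring thresholds differ at a single index, so their
final states are at squared distance at most four times its weight (`sum_norm_sq_oracle_sub_le`).
Telling them apart needs squared distance at least `4 * C_ε` (`sum_norm_sub_sq_ge`). Hence each of
`N - 1` indices has weight at least `C_ε`. -/

/-- The oracle permutes the computational basis by an involution. -/
theorem queryLabel_queryLabel {Γ : Type*} {T m : ℕ} (x : Γ → Bool) (b : BasisLabel Γ T m) :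
    queryLabel x (queryLabel x b) = b := by
  simp [queryLabel]

theorem queryLabel_involutive {Γ : Type*} {T m : ℕ} (x : Γ → Bool) :
    Function.Involutive (queryLabel (T := T) (m := m) x) :=
  queryLabel_queryLabel x

theorem oracleMatrix_mulVec {Γ : Type*} [Fintype Γ] [DecidableEq Γ] {T m : ℕ} (x : Γ → Bool)
    (v : BasisLabel Γ T m → ℂ) (c : BasisLabel Γ T m) :
    (oracleMatrix x).mulVec v c = v (queryLabel x c) := by
  have h (b : BasisLabel Γ T m) : c = queryLabel x b ↔ b = queryLabel x c :=
    ⟨fun h => by rw [h, queryLabel_queryLabel], fun h => by rw [h, queryLabel_queryLabel]⟩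
  simp [oracleMatrix, Matrix.mulVec, dotProduct, h]

/-- A unitary matrix preserves the sum of the squared norms of the entries of a vector. -/
theorem sum_norm_sq_unitary_mulVec {ι : Type*} [Fintype ι] [DecidableEq ι]
    (V : Matrix.unitaryGroup ι ℂ) (v : ι → ℂ) :
    ∑ b, ‖V.1.mulVec v b‖ ^ 2 = ∑ b, ‖v b‖ ^ 2 := by
  have key (w : ι → ℂ) : ((∑ b, ‖w b‖ ^ 2 : ℝ) : ℂ) = star w ⬝ᵥ w := by
    simp [dotProduct, ← Complex.conj_mul']
  have hV : (V.1)ᴴ * V.1 = 1 := Matrix.UnitaryGroup.star_mul_self V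
  apply Complex.ofReal_injective
  rw [key, key, Matrix.star_mulVec, ← Matrix.dotProduct_mulVec, Matrix.mulVec_mulVec, hV,
    Matrix.one_mulVec]

/-- The total squared weight of the labels of `v` that query the index `i`. -/
noncomputable def queryWeight {Γ : Type*} [Fintype Γ] [DecidableEq Γ] {T m : ℕ} (v : BasisLabel Γ T m → ℂ)
    (i : Γ) : ℝ :=
  ∑ b : BasisLabel Γ T m with i ∈ univ.image b.1, ‖v b‖ ^ 2

/-- A vector spreads total query weight at most `T` times its squared norm over the indices. -/
theorem sum_queryWeight_le {Γ : Type*} [Fintype Γ] [DecidableEq Γ] {T m : ℕ}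
    (v : BasisLabel Γ T m → ℂ) :
    ∑ i, queryWeight v i ≤ T * ∑ b, ‖v b‖ ^ 2 := by
  simp only [queryWeight, sum_filter]
  rw [sum_comm, mul_sum]
  refine sum_le_sum fun b _ => ?_
  rw [← sum_filter, sum_const, nsmul_eq_mul]
  gcongr
  simpa using (card_image_le : (univ.image b.1).card ≤ _)

theorem queryWeight_nonneg {Γ : Type*} [Fintype Γ] [DecidableEq Γ] {T m : ℕ}
    (v : BasisLabel Γ T m → ℂ) (i : Γ) : 0 ≤ queryWeight v i :=
  sum_nonneg fun _ _ => by positivity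

theorem norm_sub_sq_le_two_mul (z w : ℂ) : ‖z - w‖ ^ 2 ≤ 2 * (‖z‖ ^ 2 + ‖w‖ ^ 2) := by
  have h := parallelogram_law_with_norm ℝ z w
  nlinarith [sq_nonneg ‖z + w‖]

/-- The oracle leaves the index register alone, so it permutes the labels that query `i`. -/
theorem sum_comp_queryLabel_eq_queryWeight {Γ : Type*} [Fintype Γ] [DecidableEq Γ] {T m : ℕ}
    (v : BasisLabel Γ T m → ℂ) (i : Γ) (x : Γ → Bool) :
    ∑ b : BasisLabel Γ T m with i ∈ univ.image b.1, ‖v (queryLabel x b)‖ ^ 2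
      = queryWeight v i := by
  simp only [queryWeight, sum_filter]
  exact Equiv.sum_comp (queryLabel_involutive x).toPerm
    fun b : BasisLabel Γ T m => if i ∈ univ.image b.1 then ‖v b‖ ^ 2 else 0

/-- Black boxes that agree off `i` act almost equally on vectors that hardly query `i`. -/
theorem sum_norm_sq_oracle_sub_le {Γ : Type*} [Fintype Γ] [DecidableEq Γ] {T m : ℕ}
    (v : BasisLabel Γ T m → ℂ) (i : Γ) (x y : Γ → Bool) (hxy : ∀ j, j ≠ i → x j = y j) :
    ∑ b, ‖(oracleMatrix x).mulVec v b - (oracleMatrix y).mulVec v b‖ ^ 2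
      ≤ 4 * queryWeight v i := by
  have hzero (b : BasisLabel Γ T m) (hb : i ∉ univ.image b.1) :
      queryLabel x b = queryLabel y b := by
    have hk (k : Fin T) : x (b.1 k) = y (b.1 k) :=
      hxy _ fun h => hb (mem_image.2 ⟨k, mem_univ _, h⟩)
    simp [queryLabel, hk]
  calc
    _ = ∑ b : BasisLabel Γ T m with i ∈ univ.image b.1,
          ‖v (queryLabel x b) - v (queryLabel y b)‖ ^ 2 := by
      simp only [oracleMatrix_mulVec]
      rw [sum_filter]
      refine sum_congr rfl fun b _ => ?_
      split_ifs with h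
      · rfl
      · simp [hzero b h]
    _ ≤ ∑ b : BasisLabel Γ T m with i ∈ univ.image b.1,
          2 * (‖v (queryLabel x b)‖ ^ 2 + ‖v (queryLabel y b)‖ ^ 2) :=
      sum_le_sum fun b _ => norm_sub_sq_le_two_mul _ _
    _ = 4 * queryWeight v i := by
      rw [← mul_sum, sum_add_distrib, sum_comp_queryLabel_eq_queryWeight,
        sum_comp_queryLabel_eq_queryWeight]
      ring

/-- The reverse triangle inequality bounds the bracket by `2‖z‖‖w‖`; weighted AM-GM does the rest.
-/
theorem mul_norm_sub_sq_ge (z w : ℂ) {t : ℝ} (ht : 0 ≤ t) :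
    t * (‖z‖ ^ 2 + ‖w‖ ^ 2 - ‖z - w‖ ^ 2) ≤ t ^ 2 * ‖z‖ ^ 2 + ‖w‖ ^ 2 := by
  have h : (‖z‖ - ‖w‖) ^ 2 ≤ ‖z - w‖ ^ 2 := by
    rw [← sq_abs (‖z‖ - ‖w‖)]
    gcongr
    exact abs_norm_sub_norm_le z w
  nlinarith [sq_nonneg (t * ‖z‖ - ‖w‖), mul_le_mul_of_nonneg_left h ht]

/-- Unit vectors that a measurement tells apart with error at most `ε` are far apart,
in a form with a free parameter `t`. -/
theorem mul_sum_norm_sub_sq_ge {ι : Type*} [Fintype ι] [DecidableEq ι] (f g : ι → ℂ)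
    (hf : ∑ b, ‖f b‖ ^ 2 = 1) (hg : ∑ b, ‖g b‖ ^ 2 = 1) (S : Finset ι) {ε : ℝ}
    (hfS : 1 - ε ≤ ∑ b ∈ S, ‖f b‖ ^ 2) (hgS : 1 - ε ≤ ∑ b ∈ Sᶜ, ‖g b‖ ^ 2)
    {t : ℝ} (ht : 0 ≤ t) (ht1 : t ≤ 1) :
    t * (2 - ∑ b, ‖f b - g b‖ ^ 2) ≤ 2 * (t ^ 2 * (1 - ε) + ε) := by
  -- The factor `t ^ 2` goes to the heavy part of each vector: `f` on `S`, `g` on `Sᶜ`. As `t ≤ 1`,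
  -- the resulting bound does not increase with the heavy mass, which is at least `2 * (1 - ε)`.
  have hS := sum_le_sum fun b (_ : b ∈ S) => mul_norm_sub_sq_ge (f b) (g b) ht
  have hSc := sum_le_sum fun b (_ : b ∈ Sᶜ) => mul_norm_sub_sq_ge (g b) (f b) ht
  simp only [← mul_sum, sum_add_distrib, sum_sub_distrib, norm_sub_rev (g _)] at hS hSc
  rw [← sum_add_sum_compl S] at hf hg
  rw [← sum_add_sum_compl S (fun b => ‖f b - g b‖ ^ 2)]
  have ht2 : t ^ 2 ≤ 1 := pow_le_one₀ ht ht1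
  nlinarith

/-- The optimal parameter is `t = √ε / √(1 - ε)`, at most 1 because `ε < 1 / 2`. It vanishes at `ε =
0`, where small positive `t` serve instead. -/
theorem sum_norm_sub_sq_ge {ι : Type*} [Fintype ι] [DecidableEq ι] (f g : ι → ℂ)
    (hf : ∑ b, ‖f b‖ ^ 2 = 1) (hg : ∑ b, ‖g b‖ ^ 2 = 1) (S : Finset ι) {ε : ℝ}
    (hε : 0 ≤ ε) (hε' : ε < 1 / 2)
    (hfS : 1 - ε ≤ ∑ b ∈ S, ‖f b‖ ^ 2) (hgS : 1 - ε ≤ ∑ b ∈ Sᶜ, ‖g b‖ ^ 2) :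
    2 - 4 * √(ε * (1 - ε)) ≤ ∑ b, ‖f b - g b‖ ^ 2 := by
  have key := fun t => mul_sum_norm_sub_sq_ge f g hf hg S hfS hgS (t := t)
  set D := ∑ b, ‖f b - g b‖ ^ 2
  rcases hε.eq_or_lt with rfl | hpos
  · by_contra! h
    simp only [zero_mul, Real.sqrt_zero] at h
    have ht : 0 < min 1 ((2 - D) / 4) := lt_min one_pos (by linarith)
    have h1 := key _ ht.le (min_le_left _ _)
    have h2 := min_le_right 1 ((2 - D) / 4)
    nlinarith
  · have hs : 0 < √ε := Real.sqrt_pos.2 hpos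
    have hc : 0 < √(1 - ε) := Real.sqrt_pos.2 (by linarith)
    have hs2 : √ε ^ 2 = ε := Real.sq_sqrt hε
    have hc2 : √(1 - ε) ^ 2 = 1 - ε := Real.sq_sqrt (by linarith)
    have h := key (√ε / √(1 - ε)) (by positivity)
      ((div_le_one hc).2 (Real.sqrt_le_sqrt (by linarith)))
    rw [div_pow, hs2, hc2, div_mul_cancel₀ _ (by linarith), div_mul_eq_mul_div,
      div_le_iff₀ hc] at h
    rw [Real.sqrt_mul hε]
    have h' : √ε * (2 - D) ≤ √ε * (4 * (√ε * √(1 - ε))) := by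
      calc
        _ ≤ 2 * (ε + ε) * √(1 - ε) := h
        _ = 4 * √ε ^ 2 * √(1 - ε) := by rw [hs2]; ring
        _ = _ := by ring
    linarith [le_of_mul_le_mul_left h' hs]

namespace NonadaptiveAlgorithm

variable {Γ S' : Type*} [Fintype Γ] [DecidableEq Γ] {T : ℕ}

/-- The state `U |0⟩` before the queries. -/
noncomputable def initialState (A : NonadaptiveAlgorithm Γ S' T) :
    BasisLabel Γ T A.workQubits → ℂ :=
  A.U.1.mulVec (Pi.single A.start 1)

theorem sum_norm_sq_initialState (A : NonadaptiveAlgorithm Γ S' T) :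
    ∑ b, ‖A.initialState b‖ ^ 2 = 1 := by
  rw [initialState, sum_norm_sq_unitary_mulVec, Fintype.sum_eq_single A.start]
  · simp
  · intro b hb
    simp [hb]

theorem sum_norm_sq_finalState (A : NonadaptiveAlgorithm Γ S' T) (x : Γ → Bool) :
    ∑ b, ‖A.finalState x b‖ ^ 2 = 1 := by
  rw [finalState, sum_norm_sq_unitary_mulVec, ← A.sum_norm_sq_initialState]
  simp only [oracleMatrix_mulVec]
  exact Equiv.sum_comp (queryLabel_involutive x).toPerm fun b => ‖A.initialState b‖ ^ 2

/-- An algorithm that tells apart two black boxes that differ only at `i` queries `i` with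
weight at least `C_ε`. -/
theorem adversaryConstant_le_queryWeight [DecidableEq S'] (A : NonadaptiveAlgorithm Γ S' T)
    {F : (Γ → Bool) →. S'} {ε : ℝ} (hε : 0 ≤ ε) (hε' : ε < 1 / 2) (hA : A.Computes F ε)
    (i : Γ) {x y : Γ → Bool} (hxy : ∀ j, j ≠ i → x j = y j) {s s' : S'} (hs : s ∈ F x)
    (hs' : s' ∈ F y) (hne : s ≠ s') :
    adversaryConstant ε ≤ queryWeight A.initialState i := by
  -- The separating event is output `s`; output `s'` lies in its complement.
  have hfar := sum_norm_sub_sq_ge (A.finalState x) (A.finalState y)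
    (A.sum_norm_sq_finalState x) (A.sum_norm_sq_finalState y) (univ.filter (A.output · = s))
    hε hε' (hA x s hs) ((hA y s' hs').trans (sum_le_sum_of_subset_of_nonneg
      (fun b hb => by simp_all [eq_comm]) fun _ _ _ => by positivity))
  have hclose := sum_norm_sq_oracle_sub_le A.initialState i x y hxy
  have heq : ∑ b, ‖A.finalState x b - A.finalState y b‖ ^ 2 =
      ∑ b, ‖(oracleMatrix x).mulVec A.initialState b -
        (oracleMatrix y).mulVec A.initialState b‖ ^ 2 := by
    have := sum_norm_sq_unitary_mulVec A.V
      ((oracleMatrix x).mulVec A.initialState - (oracleMatrix y).mulVec A.initialState)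
    rw [Matrix.mulVec_sub] at this
    exact this
  rw [adversaryConstant]
  linarith

end NonadaptiveAlgorithm

/-- Querying every index once and reading off the answers computes any partial function. -/
theorem card_mem_nonadaptiveQueryCounts {N : ℕ} {S' : Type*} [DecidableEq S'] [Nonempty S']
    (F : (Fin N → Bool) →. S') {ε : ℝ} (hε : 0 ≤ ε) : N ∈ nonadaptiveQueryCounts ε F := by
  classical
  let A : NonadaptiveAlgorithm (Fin N) S' N :=
    { workQubits := 0
      U := 1
      V := 1
      -- With zero answer bits, the oracle writes `x` itself into the answer register.
      start := (id, fun _ => false, fun _ => false)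
      output := fun b => if h : (F b.2.1).Dom then (F b.2.1).get h else Classical.arbitrary S' }
  refine ⟨A, fun x s hs => ?_⟩
  have hstate (b) : A.finalState x b
      = (Pi.single A.start 1 : BasisLabel (Fin N) N 0 → ℂ) (queryLabel x b) := by
    have hU : A.U.1 = 1 := rfl
    rw [NonadaptiveAlgorithm.finalState, hU, Matrix.one_mulVec, Matrix.one_mulVec,
      oracleMatrix_mulVec]
  have hq : (queryLabel x A.start).2.1 = x := by
    funext k
    simp [queryLabel, A]
  have hout : A.output (queryLabel x A.start) = s := by
    obtain ⟨hd, rfl⟩ := hs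
    simp only [A] at hq ⊢
    simp only [hq, hd, dite_true]
  have hone : ‖A.finalState x (queryLabel x A.start)‖ ^ 2 = 1 := by
    rw [hstate, queryLabel_queryLabel]
    simp
  calc
    1 - ε ≤ ‖A.finalState x (queryLabel x A.start)‖ ^ 2 := by linarith
    _ ≤ A.outputProb x s :=
      single_le_sum (f := fun b => ‖A.finalState x b‖ ^ 2) (fun _ _ => by positivity)
        (by simpa using hout)

/-- The black box of Ordered Search with value `i`. -/
def thresholdInput {N : ℕ} (i : Fin N) : Fin N → Bool := fun j => decide (i ≤ j)

theorem mem_orderedSearch_thresholdInput {N : ℕ} (i : Fin N) :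
    i ∈ orderedSearch N (thresholdInput i) := by
  rw [mem_orderedSearch_iff]
  simp [thresholdInput]

theorem thresholdInput_castSucc_eq_succ {M : ℕ} (k : Fin M) (j : Fin (M + 1))
    (hj : j ≠ k.castSucc) : thresholdInput k.castSucc j = thresholdInput k.succ j := by
  simp only [thresholdInput, decide_eq_decide]
  rw [← Fin.castSucc_lt_iff_succ_le]
  exact ⟨fun h => lt_of_le_of_ne h hj.symm, le_of_lt⟩

theorem adversaryConstant_mul_le_of_mem_nonadaptiveQueryCounts {M T : ℕ} {ε : ℝ} (hε : 0 ≤ ε)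
    (hε' : ε < 1 / 2) (hT : T ∈ nonadaptiveQueryCounts ε (orderedSearch (M + 1))) :
    adversaryConstant ε * M ≤ T := by
  obtain ⟨A, hA⟩ := hT
  calc
    adversaryConstant ε * M = ∑ _k : Fin M, adversaryConstant ε := by simp [mul_comm]
    _ ≤ ∑ k : Fin M, queryWeight A.initialState k.castSucc :=
      sum_le_sum fun k _ => A.adversaryConstant_le_queryWeight hε hε' hA k.castSucc
        (thresholdInput_castSucc_eq_succ k) (mem_orderedSearch_thresholdInput _)
        (mem_orderedSearch_thresholdInput _) (Fin.castSucc_lt_succ).ne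
    _ ≤ ∑ i, queryWeight A.initialState i := by
      -- The last index separates no two thresholds, so its weight is dropped.
      rw [Fin.sum_univ_castSucc]
      exact le_add_of_nonneg_right (queryWeight_nonneg _ _)
    _ ≤ T * ∑ b, ‖A.initialState b‖ ^ 2 := sum_queryWeight_le _
    _ = T := by rw [A.sum_norm_sq_initialState, mul_one]

/-- For every `ε ∈ [0, 1/2)` the nonadaptive quantum query complexity of Ordered Search on
`N ≥ 1` elements is a genuine minimum, and it is at least `C_ε (N - 1)`. -/
theorem mainTheorem4 (N : ℕ) (hN : 1 ≤ N) (ε : ℝ) (hε : 0 ≤ ε) (hε' : ε < 1 / 2) :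
    (nonadaptiveQueryCounts ε (orderedSearch N)).Nonempty ∧
      adversaryConstant ε * ((N : ℝ) - 1) ≤
        (nonadaptiveQueryComplexity ε (orderedSearch N) : ℝ) := by
  obtain ⟨M, rfl⟩ : ∃ M, N = M + 1 := ⟨N - 1, by omega⟩
  have hne : (nonadaptiveQueryCounts ε (orderedSearch (M + 1))).Nonempty :=
    ⟨M + 1, card_mem_nonadaptiveQueryCounts _ hε⟩
  refine ⟨hne, ?_⟩
  rw [Nat.cast_succ, add_sub_cancel_right]
  exact adversaryConstant_mul_le_of_mem_nonadaptiveQueryCounts hε hε' (Nat.sInf_mem hne)
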